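/- **Setting.** Let $K\ge 1$ be a number of arms. A preference matrix is $Q=(q_{ij})\in[0,1]^{K\times K}$ with $q_{ij}+q_{ji}=1$ for all $i,j$ (so $q_{ii}=1/2$). An arm $c$ is a Condorcet winner of $Q$ if $q_{cj}>1/2$ for all $j\neq c$; $\mathcal Q_{\mathrm{CW}}$ is the class of preference matrices that have one (it is then unique). Put $\Delta_{ij}=q_{ij}-\tfrac12$, $\mathcal O_i=\{j: q_{ij}<1/2\}$, and $\mathrm{KL}(p,q)=p\log\frac pq+(1-p)\log\frac{1-p}{1-q}$ (with $0\log 0=0$). Let $M\ge 1$ players be the vertices of a connected undirected graph $\mathcal G$ with graph distance $d$, and let $\gamma\ge 0$ be an integer. In each round $t=1,\dots,T$ every player $m$ draws an ordered pair of arms $(i_m(t),j_m(t))$ and receives a reward $r_m(t)\in\{0,1\}$ which, given the past and the pairs drawn, is Bernoulli with mean $q_{i_m(t)j_m(t)}$, independently over players. After round $s$ player $m'$ sends to each other player $m$ with $d(m,m')\le\gamma$ a message in $\mathbb R^L$ that is a deterministic function of the pairs and rewards of $m'$ in rounds $1,\dots,s$; player $m$ can use it from round $s+d(m,m')$ on.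 The (possibly randomized) choice of $(i_m(t),j_m(t))$ depends only on the pairs and rewards of $m$ in rounds $1,\dots,t-1$ and on the messages available to $m$, and is made independently over players given these. An algorithm consists of such message functions and choice rules, and may depend on the horizon $T$; it does not know $Q$. For $Q\in\mathcal Q_{\mathrm{CW}}$ with Condorcet winner $c$, the group regret is $\mathcal R(T)=\sum_{m=1}^M\sum_{t=1}^T\tfrac12\left(\Delta_{c\,i_m(t)}+\Delta_{c\,j_m(t)}\right)$. The algorithm is consistent on $\mathcal Q_{\mathrm{CW}}$ if for every $Q\in\mathcal Q_{\mathrm{CW}}$ (with the regret taken with respect to the Condorcet winner of $Q$) and every $p>0$, $\mathbb E\,\mathcal R(T)=o(T^p)$ as $T\to\infty$. **Theorem.** For all $K$, $M$, $\mathcal G$ and $\gamma$ as above, every algorithm that is consistent on $\mathcal Q_{\mathrm{CW}}$ and every $Q\in\mathcal Q_{\mathrm{CW}}$ with Condorcet winner $c$, $$\liminf_{T\to\infty}\frac{\mathbb E\,\mathcal R(T)}{\log T}\;\ge\;\sum_{i\neq c}\ \min_{j\in\mathcal O_i}\frac{\Delta_{ci}+\Delta_{cj}}{2\,\mathrm{KL}(q_{ij},1/2)}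 .$$ In particular (taking the Condorcet winner to be arm $1$ without loss of generality) the right-hand side does not depend on $M$, $\mathcal G$ or $\gamma$. -/

import Mathlib

open Filter Topology Asymptotics

namespace DuelingBandit

/-! ### Preference matrices -/

/-- A preference matrix on `K` arms: `Q i j` is the probability that arm `i` beats arm `j`, so the
entries are Bernoulli means and `Q i j + Q j i = 1` (in particular `Q i i = 1/2` and
`Q i j ≤ 1`). -/
structure IsPreferenceMatrix {K : ℕ} (Q : Matrix (Fin K) (Fin K) ℝ) : Prop where
  nonneg : ∀ i j, 0 ≤ Q i j
  add_eq_one : ∀ i j, Q i j + Q j i = 1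

/-- Arm `c` is a Condorcet winner: it beats every other arm with probability above `1/2`. -/
def IsCondorcetWinner {K : ℕ} (Q : Matrix (Fin K) (Fin K) ℝ) (c : Fin K) : Prop :=
  ∀ j, j ≠ c → 1 / 2 < Q c j

/-- The reward gap `Δ i j = Q i j - 1/2`. -/
noncomputable def gap {K : ℕ} (Q : Matrix (Fin K) (Fin K) ℝ) (i j : Fin K) : ℝ :=
  Q i j - 1 / 2

/-- The superiors of arm `i`: the arms `j` with `Q i j < 1/2`. -/
def superiors {K : ℕ} (Q : Matrix (Fin K) (Fin K) ℝ) (i : Fin K) : Set (Fin K) :=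
  {j | Q i j < 1 / 2}

/-- Kullback-Leibler divergence between Bernoulli laws of means `p` and `q` (for `0 < q < 1`;
`0 * log 0 = 0` as usual). -/
noncomputable def bernoulliKL (p q : ℝ) : ℝ :=
  p * Real.log (p / q) + (1 - p) * Real.log ((1 - p) / (1 - q))

/-! ### Policies of `M` players communicating over a graph

Rounds are numbered from `0`, so round `t` is preceded by `t` rounds. -/

/-- What one player sees in one round: the ordered pair drawn and the binary reward
(`true` is reward `1`). -/
abbrev Draw (K : ℕ) : Type := (Fin K × Fin K) × Bool

/-- A joint history of `t` rounds: the draws of all the players. -/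
abbrev History (K M t : ℕ) : Type := Fin t → Fin M → Draw K

/-- The other players whose messages reach player `m` when the decay parameter is `γ`: those at
distance between `1` and `γ` in the communication graph. -/
abbrev Sender {M : ℕ} (G : SimpleGraph (Fin M)) (γ : ℕ) (m : Fin M) : Type :=
  {m' : Fin M // 0 < G.dist m m' ∧ G.dist m m' ≤ γ}

/-- A policy: a communication policy together with an action policy. -/
structure Policy (K M : ℕ) (G : SimpleGraph (Fin M)) (γ : ℕ) where
  /-- the dimension of the messages -/
  L : ℕ
  /-- `message m m' s h` is sent by player `m` to player `m'` at the end of round `s`; it is a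
  function of the draws `h` of player `m` in the rounds `0, …, s`. It can be used by `m'` from round
  `s + dist m m'` on (and never if `dist m m' > γ`). -/
  message : (m m' : Fin M) → (s : ℕ) → (Fin (s + 1) → Draw K) → (Fin L → ℝ)
  /-- The law of the pair drawn by player `m` in round `t`, given the own `t` past draws and all the
  messages received so far: those that each sender `m'` sent in rounds `s ≤ t - dist m m'`. As
  rewards are binary, only finitely many arguments ever occur in a given round. -/
  action : (m : Fin M) → (t : ℕ) → (Fin t → Draw K) →
    ((m' : Sender G γ m) → Fin (t + 1 - G.dist m m') → (Fin L → ℝ)) → PMF (Fin K × Fin K)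

variable {K M : ℕ} {G : SimpleGraph (Fin M)} {γ : ℕ}

/-- The law of the pair drawn by player `m` in round `t`, given the joint history `h` of the
preceding rounds, of which the policy uses only the draws of `m` itself and the messages. -/
noncomputable def Policy.drawLaw (π : Policy K M G γ) (m : Fin M) (t : ℕ) (h : History K M t) :
    PMF (Fin K × Fin K) :=
  π.action m t (fun s => h s m) fun m' s =>
    π.message m' m s fun u =>
      h ⟨u, by have := m'.2.1; have := s.2; have := u.2; omega⟩ m'

/-- The Bernoulli mass function with mean `q`. -/
def rewardProb (q : ℝ) (r : Bool) : ℝ := if r then q else 1 - q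

/-- The probability of an outcome `ω` of `T` rounds under policy `π` and preference matrix `Q`:
given the past, each player draws a pair from the law that the policy prescribes, and gets a
Bernoulli reward whose mean is the entry of `Q` at that pair. -/
noncomputable def outcomeProb (π : Policy K M G γ) (Q : Matrix (Fin K) (Fin K) ℝ) (T : ℕ)
    (ω : History K M T) : ℝ :=
  ∏ t : Fin T, ∏ m : Fin M,
    (π.drawLaw m t (fun s => ω ⟨s, s.2.trans t.2⟩) (ω t m).1).toReal *
      rewardProb (Q (ω t m).1.1 (ω t m).1.2) (ω t m).2

/-- The group regret of an outcome of `T` rounds with respect to the Condorcet winner `c`. -/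
noncomputable def groupRegret (Q : Matrix (Fin K) (Fin K) ℝ) (c : Fin K) (T : ℕ)
    (ω : History K M T) : ℝ :=
  ∑ m : Fin M, ∑ t : Fin T, (1 / 2) * (gap Q c (ω t m).1.1 + gap Q c (ω t m).1.2)

/-- An algorithm may be told the time horizon: it is a family of policies, of which the one with
index `T` is used when there are `T` rounds. (A constant family does not use the horizon.) -/
abbrev Algorithm (K M : ℕ) (G : SimpleGraph (Fin M)) (γ : ℕ) : Type := ℕ → Policy K M G γ

/-- The expected group regret of an algorithm over `T` rounds (the outcome space is finite). -/
noncomputable def expectedRegret (A : Algorithm K M G γ) (Q : Matrix (Fin K) (Fin K) ℝ)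
    (c : Fin K) (T : ℕ) : ℝ :=
  ∑ ω : History K M T, outcomeProb (A T) Q T ω * groupRegret Q c T ω

/-- Consistency over the class of preference matrices with a Condorcet winner: on each of them,
wherever its winner `c` is, the expected regret is `o(T ^ p)` for every `p > 0`. -/
def Consistent (A : Algorithm K M G γ) : Prop :=
  ∀ (Q : Matrix (Fin K) (Fin K) ℝ) (c : Fin K), IsPreferenceMatrix Q → IsCondorcetWinner Q c →
    ∀ p : ℝ, 0 < p → (fun T : ℕ => expectedRegret A Q c T) =o[atTop] fun T : ℕ => (T : ℝ) ^ p

end DuelingBandit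

/-!
For a suboptimal arm `i`, let `Q'` be `Q` with the entries of `i` against its superiors, and
against the arms it ties with, raised just above `1/2`, so that `i` becomes the Condorcet winner.
A consistent algorithm must play almost exclusively the pair `(i, i)` under `Q'` and almost never
under `Q`. Hence it has to tell `Q` from `Q'`, and only the duels of `i` with the arms concerned
help it to do so. Communication does not matter, for the information is counted over the draws of
all the players, as the regret is: in `outcomeProb` the policy enters through the conditional laws
of the pairs alone, and these cancel in the likelihood ratio of `Q` to `Q'`, however much of the
joint history they depend on.

The quantitative form is the Donsker–Varadhan inequality
`expect_le_expect_bernoulliKL_add_log`, in which the chain rule turns the relative entropy of the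
outcomes into the expected sum of the Bernoulli divergences of the pairs drawn. It is applied to
`(1 - p) log T` times the fraction of the draws that are not `(i, i)`. This fraction is near `1` on
average under `Q`, while under `Q'` its mean is at most `T ^ (p - 1)`, which keeps the exponential
moment below `2`. The result, `eventually_log_le_expect_drawInfo`, is that the draws carry
`(1 - ε) log T` nats of information about each suboptimal `i`, up to `ε` times the regret. That
error term accounts for the excess over `1/2` of the raised entries, and for the ties: every draw
of `i` costs at least half the gap of `i`, so that the number of these draws is at most a constant
times the regret.

A draw informs about one arm at most, the weaker of the pair, and its regret is at least `infoPrice`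
times that information (`sum_infoPrice_mul_drawInfo_le`). Summing over `i` bounds the regret from
below by `(1 - ε) S / (1 + ε S) * log T`, where `S` is the sum of the prices, and `ε` tends to `0`.
-/

namespace DuelingBandit

variable {K M : ℕ} {G : SimpleGraph (Fin M)} {γ : ℕ}

/-! ### Expectations over outcomes -/

/-- The expectation of `f` over the outcomes of `T` rounds of policy `π` under `Q`. -/
noncomputable def expect (π : Policy K M G γ) (Q : Matrix (Fin K) (Fin K) ℝ) (T : ℕ)
    (f : History K M T → ℝ) : ℝ :=
  ∑ ω : History K M T, outcomeProb π Q T ω * f ω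

/-- The total of `f` over all the draws of an outcome. -/
def drawSum {T : ℕ} (f : Draw K → ℝ) (ω : History K M T) : ℝ :=
  ∑ t : Fin T, ∑ m : Fin M, f (ω t m)

theorem rewardProb_sum (q : ℝ) : ∑ r : Bool, rewardProb q r = 1 := by
  simp [rewardProb]

theorem rewardProb_nonneg {q : ℝ} (h0 : 0 ≤ q) (h1 : q ≤ 1) (r : Bool) : 0 ≤ rewardProb q r := by
  cases r <;> simp [rewardProb, h0, h1]

theorem IsPreferenceMatrix.le_one {Q : Matrix (Fin K) (Fin K) ℝ} (hQ : IsPreferenceMatrix Q)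
    (i j : Fin K) : Q i j ≤ 1 := by
  linarith [hQ.add_eq_one i j, hQ.nonneg j i]

theorem IsPreferenceMatrix.diag {Q : Matrix (Fin K) (Fin K) ℝ} (hQ : IsPreferenceMatrix Q)
    (i : Fin K) : Q i i = 1 / 2 := by
  linarith [hQ.add_eq_one i i]

theorem outcomeProb_nonneg (π : Policy K M G γ) {Q : Matrix (Fin K) (Fin K) ℝ}
    (hQ : IsPreferenceMatrix Q) (T : ℕ) (ω : History K M T) : 0 ≤ outcomeProb π Q T ω :=
  Finset.prod_nonneg fun _ _ => Finset.prod_nonneg fun _ _ =>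
    mul_nonneg ENNReal.toReal_nonneg (rewardProb_nonneg (hQ.nonneg _ _) (hQ.le_one _ _) _)

/-- The joint law of a pair and its reward, when the pair has law `μ`. -/
noncomputable def drawProb (μ : PMF (Fin K × Fin K)) (Q : Matrix (Fin K) (Fin K) ℝ)
    (d : Draw K) : ℝ :=
  (μ d.1).toReal * rewardProb (Q d.1.1 d.1.2) d.2

/-- A function of a draw with the same mean `v` given each pair has mean `v`. -/
theorem sum_drawProb_mul (μ : PMF (Fin K × Fin K)) (Q : Matrix (Fin K) (Fin K) ℝ)
    (f : Draw K → ℝ) (v : ℝ)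
    (hf : ∀ x : Fin K × Fin K, ∑ r : Bool, rewardProb (Q x.1 x.2) r * f (x, r) = v) :
    ∑ d : Draw K, drawProb μ Q d * f d = v := by
  have h1 : ∑ x : Fin K × Fin K, (μ x).toReal = 1 := by
    rw [← ENNReal.toReal_sum fun x _ => μ.apply_ne_top x, ← tsum_fintype (L := .unconditional _),
      μ.tsum_coe, ENNReal.toReal_one]
  rw [Fintype.sum_prod_type]
  simp only [drawProb, mul_assoc, ← Finset.mul_sum, hf]
  rw [← Finset.sum_mul, h1, one_mul]

theorem sum_drawProb (μ : PMF (Fin K × Fin K)) (Q : Matrix (Fin K) (Fin K) ℝ) :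
    ∑ d : Draw K, drawProb μ Q d = 1 := by
  simpa using sum_drawProb_mul μ Q (fun _ => 1) 1 fun x => by simpa using rewardProb_sum _

theorem outcomeProb_snoc (π : Policy K M G γ) (Q : Matrix (Fin K) (Fin K) ℝ) (T : ℕ)
    (h : History K M T) (x : Fin M → Draw K) :
    outcomeProb π Q (T + 1) (Fin.snoc (α := fun _ => Fin M → Draw K) h x) =
      outcomeProb π Q T h * ∏ m, drawProb (π.drawLaw m T h) Q (x m) := by
  have key : ∀ (t : ℕ) (ht : t < T),
      Fin.snoc (α := fun _ => Fin M → Draw K) h x ⟨t, ht.trans T.lt_succ_self⟩ = h ⟨t, ht⟩ :=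
    fun t ht => Fin.snoc_castSucc (α := fun _ => Fin M → Draw K) x h ⟨t, ht⟩
  rw [outcomeProb, Fin.prod_univ_castSucc]
  congr 1
  · refine Finset.prod_congr rfl fun t _ => Finset.prod_congr rfl fun m _ => ?_
    rw [Fin.snoc_castSucc]
    congr 4
    funext s
    exact key s (s.2.trans t.2)
  · refine Finset.prod_congr rfl fun m _ => ?_
    rw [Fin.snoc_last, drawProb]
    congr 4
    funext s
    exact key s s.2

theorem sum_history_succ (T : ℕ) (F : History K M (T + 1) → ℝ) :
    ∑ ω, F ω = ∑ h : History K M T, ∑ x : Fin M → Draw K,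
      F (Fin.snoc (α := fun _ => Fin M → Draw K) h x) := by
  rw [← (Fin.snocEquiv fun _ : Fin (T + 1) => Fin M → Draw K).sum_comp, Fintype.sum_prod_type,
    Finset.sum_comm]
  rfl

theorem sum_prod_drawProb (μ : Fin M → PMF (Fin K × Fin K)) (Q : Matrix (Fin K) (Fin K) ℝ) :
    ∑ x : Fin M → Draw K, ∏ m, drawProb (μ m) Q (x m) = 1 := by
  rw [← Fintype.prod_sum]
  exact Finset.prod_eq_one fun m _ => sum_drawProb _ _

theorem sum_prod_drawProb_mul_eq_zero (μ : Fin M → PMF (Fin K × Fin K))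
    (Q : Matrix (Fin K) (Fin K) ℝ) (f : Draw K → ℝ)
    (hf : ∀ x : Fin K × Fin K, ∑ r : Bool, rewardProb (Q x.1 x.2) r * f (x, r) = 0) (m₀ : Fin M) :
    ∑ x : Fin M → Draw K, (∏ m, drawProb (μ m) Q (x m)) * f (x m₀) = 0 := by
  have h : ∀ x : Fin M → Draw K, (∏ m, drawProb (μ m) Q (x m)) * f (x m₀) =
      ∏ m, drawProb (μ m) Q (x m) * if m = m₀ then f (x m) else 1 := fun x => by
    rw [Finset.prod_mul_distrib, Finset.prod_ite_eq' Finset.univ m₀ fun m => f (x m)]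
    simp
  simp only [h]
  rw [← Fintype.prod_sum fun m (d : Draw K) => drawProb (μ m) Q d * if m = m₀ then f d else 1]
  refine Finset.prod_eq_zero (Finset.mem_univ m₀) ?_
  simpa using sum_drawProb_mul (μ m₀) Q f 0 hf

theorem sum_outcomeProb (π : Policy K M G γ) (Q : Matrix (Fin K) (Fin K) ℝ) (T : ℕ) :
    ∑ ω, outcomeProb π Q T ω = 1 := by
  induction T with
  | zero => simp [outcomeProb]
  | succ T ih =>
    rw [sum_history_succ]
    simp only [outcomeProb_snoc, ← Finset.mul_sum, sum_prod_drawProb, mul_one, ih]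

/-- Rewards enter the outcome only through their conditional law given the pairs: a function of a
draw that is centred given the pair sums to zero in expectation, whatever the policy. -/
theorem expect_drawSum_eq_zero (π : Policy K M G γ) (Q : Matrix (Fin K) (Fin K) ℝ) (T : ℕ)
    (f : Draw K → ℝ)
    (hf : ∀ x : Fin K × Fin K, ∑ r : Bool, rewardProb (Q x.1 x.2) r * f (x, r) = 0) :
    expect π Q T (drawSum f) = 0 := by
  induction T with
  | zero => simp [expect, drawSum]
  | succ T ih =>
    have hsplit : ∀ (h : History K M T) (x : Fin M → Draw K),
        drawSum f (Fin.snoc (α := fun _ => Fin M → Draw K) h x) = drawSum f h + ∑ m, f (x m) := by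
      intro h x
      simp [drawSum, Fin.sum_univ_castSucc]
    rw [expect, sum_history_succ]
    simp only [outcomeProb_snoc, hsplit, mul_assoc, mul_add, Finset.sum_add_distrib,
      ← Finset.mul_sum]
    have h2 : ∀ h : History K M T, ∑ x : Fin M → Draw K,
        (∏ m, drawProb (π.drawLaw m T h) Q (x m)) * ∑ m, f (x m) = 0 := fun h => by
      simp only [Finset.mul_sum]
      rw [Finset.sum_comm]
      exact Finset.sum_eq_zero fun m₀ _ => sum_prod_drawProb_mul_eq_zero _ Q f hf m₀
    simp only [h2, mul_zero, Finset.sum_const_zero, add_zero]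
    rw [← ih, expect]
    refine Finset.sum_congr rfl fun h _ => ?_
    rw [← Finset.sum_mul, sum_prod_drawProb, one_mul]

theorem expect_add (π : Policy K M G γ) (Q : Matrix (Fin K) (Fin K) ℝ) (T : ℕ)
    (f g : History K M T → ℝ) :
    expect π Q T (fun ω => f ω + g ω) = expect π Q T f + expect π Q T g := by
  simp [expect, mul_add, Finset.sum_add_distrib]

theorem expect_const_mul (π : Policy K M G γ) (Q : Matrix (Fin K) (Fin K) ℝ) (T : ℕ)
    (a : ℝ) (f : History K M T → ℝ) :
    expect π Q T (fun ω => a * f ω) = a * expect π Q T f := by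
  simp [expect, Finset.mul_sum, mul_left_comm]

theorem expect_const (π : Policy K M G γ) (Q : Matrix (Fin K) (Fin K) ℝ) (T : ℕ) (a : ℝ) :
    expect π Q T (fun _ => a) = a := by
  rw [expect, ← Finset.sum_mul, sum_outcomeProb, one_mul]

theorem expect_mono (π : Policy K M G γ) {Q : Matrix (Fin K) (Fin K) ℝ}
    (hQ : IsPreferenceMatrix Q) {T : ℕ} {f g : History K M T → ℝ} (h : ∀ ω, f ω ≤ g ω) :
    expect π Q T f ≤ expect π Q T g :=
  Finset.sum_le_sum fun ω _ => mul_le_mul_of_nonneg_left (h ω) (outcomeProb_nonneg π hQ T ω)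

theorem drawSum_mono {T : ℕ} {f g : Draw K → ℝ} (h : ∀ d, f d ≤ g d) (ω : History K M T) :
    drawSum f ω ≤ drawSum g ω :=
  Finset.sum_le_sum fun _ _ => Finset.sum_le_sum fun _ _ => h _

theorem drawSum_add {T : ℕ} (f g : Draw K → ℝ) (ω : History K M T) :
    drawSum (fun d => f d + g d) ω = drawSum f ω + drawSum g ω := by
  simp [drawSum, Finset.sum_add_distrib]

theorem drawSum_const_mul {T : ℕ} (a : ℝ) (f : Draw K → ℝ) (ω : History K M T) :
    drawSum (fun d => a * f d) ω = a * drawSum f ω := by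
  simp [drawSum, Finset.mul_sum]

theorem drawSum_one {T : ℕ} (ω : History K M T) : drawSum (fun _ => 1) ω = M * T := by
  simp [drawSum, mul_comm]

theorem expect_sum (π : Policy K M G γ) (Q : Matrix (Fin K) (Fin K) ℝ) (T : ℕ) {ι : Type*}
    (s : Finset ι) (f : ι → History K M T → ℝ) :
    expect π Q T (fun ω => ∑ i ∈ s, f i ω) = ∑ i ∈ s, expect π Q T (f i) := by
  simp only [expect, Finset.mul_sum]
  exact Finset.sum_comm

theorem drawSum_sum {T : ℕ} {ι : Type*} (s : Finset ι) (f : ι → Draw K → ℝ)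
    (ω : History K M T) :
    drawSum (fun d => ∑ i ∈ s, f i d) ω = ∑ i ∈ s, drawSum (f i) ω := by
  simp only [drawSum]
  rw [Finset.sum_comm]
  simp only [Finset.sum_comm (s := s)]
  rw [Finset.sum_comm]

/-! ### Change of measure -/

/-- The change of measure in Donsker–Varadhan form: the relative entropy of the laws of the outcome
under `Q` and `Q'`, which the chain rule turns into expected Bernoulli divergences of the pairs
drawn, bounds the `Q`-mean of every `f` up to the logarithm of an exponential moment under `Q'`. -/
theorem expect_le_expect_bernoulliKL_add_log (π : Policy K M G γ) {Q Q' : Matrix (Fin K) (Fin K) ℝ}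
    (hQ : IsPreferenceMatrix Q) (hQ' : IsPreferenceMatrix Q')
    (hac : ∀ i j, Q' i j = Q i j ∨ 0 < Q' i j ∧ Q' i j < 1) (T : ℕ) (f : History K M T → ℝ)
    {Z : ℝ} (hZ : 0 < Z) (hf : expect π Q' T (fun ω => Real.exp (f ω)) ≤ Z) :
    expect π Q T f ≤
      expect π Q T (drawSum fun d => bernoulliKL (Q d.1.1 d.1.2) (Q' d.1.1 d.1.2)) +
        Real.log Z := by
  set llr : Draw K → ℝ := fun d =>
    Real.log (rewardProb (Q d.1.1 d.1.2) d.2 / rewardProb (Q' d.1.1 d.1.2) d.2) with hllr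
  set kl : Draw K → ℝ := fun d => bernoulliKL (Q d.1.1 d.1.2) (Q' d.1.1 d.1.2) with hkl
  -- The log-likelihood ratio of a reward has mean the Bernoulli divergence, given the pair.
  have hmean : expect π Q T (drawSum llr) = expect π Q T (drawSum kl) := by
    have h0 : expect π Q T (drawSum fun d => llr d + (-1) * kl d) = 0 := by
      refine expect_drawSum_eq_zero π Q T _ fun x => ?_
      simp [hllr, hkl, rewardProb, bernoulliKL]
      ring
    simp only [funext fun ω : History K M T => drawSum_add (T := T) llr (fun d => -1 * kl d) ω,
      drawSum_const_mul, expect_add, expect_const_mul] at h0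
    linarith
  have hpt : ∀ ω : History K M T, outcomeProb π Q T ω * (f ω - drawSum llr ω - Real.log Z) ≤
      outcomeProb π Q' T ω * Real.exp (f ω) / Z - outcomeProb π Q T ω := by
    intro ω
    rcases (outcomeProb_nonneg π hQ T ω).eq_or_lt with h | hpos
    · rw [← h, zero_mul, sub_zero]
      have := outcomeProb_nonneg π hQ' T ω
      positivity
    have hr : ∀ t m, rewardProb (Q (ω t m).1.1 (ω t m).1.2) (ω t m).2 ≠ 0 := by
      intro t m h0
      refine hpos.ne' (Finset.prod_eq_zero (Finset.mem_univ t) (Finset.prod_eq_zero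
        (Finset.mem_univ m) ?_))
      rw [h0, mul_zero]
    have hr' : ∀ t m, rewardProb (Q' (ω t m).1.1 (ω t m).1.2) (ω t m).2 ≠ 0 := by
      intro t m
      rcases hac (ω t m).1.1 (ω t m).1.2 with h | ⟨h1, h2⟩
      · rw [h]; exact hr t m
      · cases (ω t m).2 <;> simp [rewardProb] <;> linarith
    have hexp : Real.exp (drawSum llr ω) * outcomeProb π Q' T ω = outcomeProb π Q T ω := by
      rw [drawSum, Real.exp_sum, outcomeProb, ← Finset.prod_mul_distrib, outcomeProb]
      refine Finset.prod_congr rfl fun t _ => ?_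
      rw [Real.exp_sum, ← Finset.prod_mul_distrib]
      refine Finset.prod_congr rfl fun m _ => ?_
      have h1 := (rewardProb_nonneg (hQ.nonneg (ω t m).1.1 (ω t m).1.2)
        (hQ.le_one _ _) (ω t m).2).lt_of_ne' (hr t m)
      have h2 := (rewardProb_nonneg (hQ'.nonneg (ω t m).1.1 (ω t m).1.2)
        (hQ'.le_one _ _) (ω t m).2).lt_of_ne' (hr' t m)
      rw [hllr, Real.exp_log (div_pos h1 h2)]
      field_simp
    have hexp' : outcomeProb π Q' T ω = outcomeProb π Q T ω * Real.exp (-drawSum llr ω) := by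
      rw [← hexp, mul_right_comm, ← Real.exp_add]
      simp
    have hle := Real.add_one_le_exp (f ω - drawSum llr ω - Real.log Z)
    have heq : Real.exp (f ω - drawSum llr ω - Real.log Z) =
        Real.exp (-drawSum llr ω) * Real.exp (f ω) / Z := by
      rw [Real.exp_sub, Real.exp_log hZ, ← Real.exp_add]
      ring_nf
    -- The inequality `log x ≤ x - 1` for `x` the density ratio weighted by `exp (f ω) / Z`.
    rw [heq] at hle
    calc _ ≤ outcomeProb π Q T ω * (Real.exp (-drawSum llr ω) * Real.exp (f ω) / Z - 1) :=
          mul_le_mul_of_nonneg_left (by linarith) hpos.le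
      _ = _ := by rw [hexp']; ring
  have hsum := Finset.sum_le_sum fun ω (_ : ω ∈ Finset.univ) => hpt ω
  rw [Finset.sum_sub_distrib, sum_outcomeProb, ← Finset.sum_div] at hsum
  have hZ1 : (∑ ω, outcomeProb π Q' T ω * Real.exp (f ω)) / Z ≤ 1 := (div_le_one hZ).2 hf
  have hlhs : ∑ ω, outcomeProb π Q T ω * (f ω - drawSum llr ω - Real.log Z) =
      expect π Q T f - expect π Q T (drawSum llr) - Real.log Z := by
    simp only [mul_sub, Finset.sum_sub_distrib, ← Finset.sum_mul, sum_outcomeProb, one_mul, expect]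
  rw [hlhs, hmean] at hsum
  linarith

/-! ### Bernoulli divergences -/

theorem bernoulliKL_self (p : ℝ) : bernoulliKL p p = 0 := by
  have h : ∀ x : ℝ, x * Real.log (x / x) = 0 := fun x => by
    rcases eq_or_ne x 0 with rfl | hx <;> simp [*]
  simp only [bernoulliKL, h, add_zero]

theorem bernoulliKL_one_sub (p q : ℝ) : bernoulliKL (1 - p) (1 - q) = bernoulliKL p q := by
  simp [bernoulliKL, add_comm]

theorem bernoulliKL_half_add_le {p δ : ℝ} (h0 : 0 ≤ p) (hδ : 0 ≤ δ) (hδ' : δ < 1 / 2) :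
    bernoulliKL p (1 / 2 + δ) ≤ bernoulliKL p (1 / 2) - Real.log (1 - 2 * δ) := by
  have hlog : ∀ x y : ℝ, 0 < y → x * Real.log (x / y) = x * Real.log x - x * Real.log y := by
    intro x y hy
    rcases eq_or_ne x 0 with rfl | hx
    · simp
    · rw [Real.log_div hx hy.ne']; ring
  rw [bernoulliKL, bernoulliKL, hlog _ _ (by linarith), hlog _ _ (by linarith),
    hlog _ _ (by norm_num), hlog _ _ (by norm_num)]
  have e1 : Real.log (1 / 2) ≤ Real.log (1 / 2 + δ) := Real.log_le_log (by norm_num) (by linarith)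
  have e2 : Real.log (1 - (1 / 2 + δ)) = Real.log (1 / 2) + Real.log (1 - 2 * δ) := by
    rw [← Real.log_mul (by norm_num) (by linarith)]
    ring_nf
  have e3 : Real.log (1 - 2 * δ) ≤ 0 := Real.log_nonpos (by linarith) (by linarith)
  have e4 : (1 : ℝ) - 1 / 2 = 1 / 2 := by norm_num
  rw [e2, e4]
  nlinarith [mul_le_mul_of_nonneg_left e1 h0]

theorem bernoulliKL_half_nonneg {p : ℝ} (h0 : 0 ≤ p) (h1 : p ≤ 1) : 0 ≤ bernoulliKL p (1 / 2) := by
  have h : ∀ x : ℝ, 0 ≤ x → x - 1 / 2 ≤ x * Real.log (x / (1 / 2)) := by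
    intro x hx
    rcases hx.eq_or_lt with rfl | hx
    · norm_num
    · have := Real.one_sub_inv_le_log_of_pos (show 0 < x / (1 / 2) by positivity)
      calc x - 1 / 2 = x * (1 - (x / (1 / 2))⁻¹) := by field_simp
        _ ≤ _ := mul_le_mul_of_nonneg_left this hx.le
  have e4 : (1 : ℝ) - 1 / 2 = 1 / 2 := by norm_num
  rw [bernoulliKL, e4]
  linarith [h p h0, h (1 - p) (by linarith)]

/-! ### Regret of a single draw -/

/-- The regret of one draw with respect to the Condorcet winner `c`. -/
noncomputable def drawRegret (Q : Matrix (Fin K) (Fin K) ℝ) (c : Fin K) (d : Draw K) : ℝ :=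
  (1 / 2) * (gap Q c d.1.1 + gap Q c d.1.2)

theorem expectedRegret_eq_expect (A : Algorithm K M G γ) (Q : Matrix (Fin K) (Fin K) ℝ)
    (c : Fin K) (T : ℕ) :
    expectedRegret A Q c T = expect (A T) Q T (drawSum (drawRegret Q c)) := by
  refine Finset.sum_congr rfl fun ω _ => ?_
  rw [groupRegret, Finset.sum_comm]
  rfl

theorem gap_nonneg {Q : Matrix (Fin K) (Fin K) ℝ} (hQ : IsPreferenceMatrix Q) {c : Fin K}
    (hc : IsCondorcetWinner Q c) (j : Fin K) : 0 ≤ gap Q c j := by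
  rcases eq_or_ne j c with rfl | h
  · simp [gap, hQ.diag]
  · simpa [gap] using (hc j h).le

theorem drawRegret_nonneg {Q : Matrix (Fin K) (Fin K) ℝ} (hQ : IsPreferenceMatrix Q) {c : Fin K}
    (hc : IsCondorcetWinner Q c) (d : Draw K) : 0 ≤ drawRegret Q c d := by
  have := gap_nonneg hQ hc d.1.1
  have := gap_nonneg hQ hc d.1.2
  unfold drawRegret
  positivity

theorem expectedRegret_nonneg (A : Algorithm K M G γ) {Q : Matrix (Fin K) (Fin K) ℝ}
    (hQ : IsPreferenceMatrix Q) {c : Fin K} (hc : IsCondorcetWinner Q c) (T : ℕ) :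
    0 ≤ expectedRegret A Q c T := by
  rw [expectedRegret_eq_expect, ← expect_const (A T) Q T 0]
  exact expect_mono _ hQ fun ω => Finset.sum_nonneg fun _ _ => Finset.sum_nonneg fun _ _ =>
    drawRegret_nonneg hQ hc _

/-- The indicator that arm `i` takes part in a draw. -/
def involves (i : Fin K) (d : Draw K) : ℝ := if d.1.1 = i ∨ d.1.2 = i then 1 else 0

/-- The indicator that a draw is not the pair of `i` with itself. -/
def notSelf (i : Fin K) (d : Draw K) : ℝ := if d.1 = (i, i) then 0 else 1

theorem one_le_notSelf_add_involves (i : Fin K) (d : Draw K) :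
    1 ≤ notSelf i d + involves i d := by
  obtain ⟨⟨a, b⟩, r⟩ := d
  simp only [notSelf, involves, Prod.mk.injEq]
  split_ifs <;> simp_all

theorem involves_le {Q : Matrix (Fin K) (Fin K) ℝ} (hQ : IsPreferenceMatrix Q) {c : Fin K}
    (hc : IsCondorcetWinner Q c) {i : Fin K} (hi : i ≠ c) (d : Draw K) :
    involves i d ≤ 2 / gap Q c i * drawRegret Q c d := by
  have hpos : 0 < gap Q c i := by simpa [gap] using hc i hi
  rw [involves]
  split_ifs with h
  · rw [div_mul_eq_mul_div, one_le_div hpos, drawRegret]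
    have h1 := gap_nonneg hQ hc d.1.1
    have h2 := gap_nonneg hQ hc d.1.2
    rcases h with rfl | rfl <;> linarith
  · exact mul_nonneg (by positivity) (drawRegret_nonneg hQ hc d)

theorem exists_notSelf_le {Q : Matrix (Fin K) (Fin K) ℝ} (hQ : IsPreferenceMatrix Q) {c : Fin K}
    (hc : IsCondorcetWinner Q c) :
    ∃ k : ℝ, 0 < k ∧ ∀ d : Draw K, notSelf c d ≤ k * drawRegret Q c d := by
  have hS : ∀ i, 0 ≤ 2 / gap Q c i := fun i => div_nonneg two_pos.le (gap_nonneg hQ hc i)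
  have hk : 0 < 1 + ∑ i, 2 / gap Q c i := by
    linarith [Finset.sum_nonneg fun i (_ : i ∈ Finset.univ) => hS i]
  refine ⟨_, hk, fun d => ?_⟩
  have hn := drawRegret_nonneg hQ hc d
  have main : ∀ i ≠ c, involves i d ≤ (1 + ∑ i, 2 / gap Q c i) * drawRegret Q c d := fun i hi => by
    refine (involves_le hQ hc hi d).trans (mul_le_mul_of_nonneg_right ?_ hn)
    linarith [Finset.single_le_sum (fun i _ => hS i) (Finset.mem_univ i)]
  rw [notSelf]
  split_ifs with h
  · exact mul_nonneg hk.le hn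
  · by_cases ha : d.1.1 = c
    · have hb : d.1.2 ≠ c := fun hb => h (Prod.ext ha hb)
      simpa [involves] using main _ hb
    · simpa [involves] using main _ ha

/-! ### The alternative in which a given arm wins -/

/-- The matrix `Q` with the entries of arm `i` changed so that it beats, with probability
`1/2 + δ`, every other arm that it did not beat. Ties are raised as well as losses, for a Condorcet
winner has to beat every other arm strictly. -/
noncomputable def promote (Q : Matrix (Fin K) (Fin K) ℝ) (i : Fin K) (δ : ℝ) :
    Matrix (Fin K) (Fin K) ℝ := fun a b =>
  if a = i ∧ b ≠ i ∧ Q i b ≤ 1 / 2 then 1 / 2 + δ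
  else if b = i ∧ a ≠ i ∧ Q i a ≤ 1 / 2 then 1 / 2 - δ
  else Q a b

theorem promote_isPreferenceMatrix {Q : Matrix (Fin K) (Fin K) ℝ} (hQ : IsPreferenceMatrix Q)
    (i : Fin K) {δ : ℝ} (hδ : 0 < δ) (hδ' : δ < 1 / 2) : IsPreferenceMatrix (promote Q i δ) where
  nonneg a b := by
    unfold promote
    split_ifs
    · linarith
    · linarith
    · exact hQ.nonneg a b
  add_eq_one a b := by
    have := hQ.add_eq_one a b
    unfold promote
    split_ifs <;> first | linarith | simp_all

theorem promote_isCondorcetWinner (Q : Matrix (Fin K) (Fin K) ℝ) (i : Fin K) {δ : ℝ}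
    (hδ : 0 < δ) : IsCondorcetWinner (promote Q i δ) i := by
  intro j hj
  unfold promote
  split_ifs with h1 h2
  · linarith
  · exact absurd h2.1 hj
  · by_contra h
    exact h1 ⟨rfl, hj, not_lt.1 h⟩

theorem promote_eq_or (Q : Matrix (Fin K) (Fin K) ℝ) (i : Fin K) {δ : ℝ} (hδ : 0 < δ)
    (hδ' : δ < 1 / 2) (a b : Fin K) :
    promote Q i δ a b = Q a b ∨ 0 < promote Q i δ a b ∧ promote Q i δ a b < 1 := by
  unfold promote
  split_ifs
  · right; constructor <;> linarith
  · right; constructor <;> linarith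
  · exact .inl rfl

/-- The information that a draw gives against the hypothesis that `i` ties with its superiors: the
divergence from `1/2` if the draw is of `i` and one of its superiors, in either order, and zero
otherwise. -/
noncomputable def drawInfo (Q : Matrix (Fin K) (Fin K) ℝ) (i : Fin K) (d : Draw K) : ℝ :=
  if d.1.1 = i ∧ Q i d.1.2 < 1 / 2 then bernoulliKL (Q i d.1.2) (1 / 2)
  else if d.1.2 = i ∧ Q i d.1.1 < 1 / 2 then bernoulliKL (Q i d.1.1) (1 / 2)
  else 0

theorem bernoulliKL_promote_le {Q : Matrix (Fin K) (Fin K) ℝ} (hQ : IsPreferenceMatrix Q)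
    (i : Fin K) {δ : ℝ} (hδ : 0 < δ) (hδ' : δ < 1 / 2) (d : Draw K) :
    bernoulliKL (Q d.1.1 d.1.2) (promote Q i δ d.1.1 d.1.2) ≤
      drawInfo Q i d + -Real.log (1 - 2 * δ) * involves i d := by
  obtain ⟨⟨a, b⟩, r⟩ := d
  have hη : 0 ≤ -Real.log (1 - 2 * δ) :=
    neg_nonneg.2 (Real.log_nonpos (by linarith) (by linarith))
  have hinfo : 0 ≤ drawInfo Q i ((a, b), r) := by
    unfold drawInfo
    split_ifs
    · exact bernoulliKL_half_nonneg (hQ.nonneg _ _) (hQ.le_one _ _)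
    · exact bernoulliKL_half_nonneg (hQ.nonneg _ _) (hQ.le_one _ _)
    · exact le_rfl
  -- A tie carries no information, so that it can be counted among the superiors.
  have hcase : ∀ j, Q i j ≤ 1 / 2 → bernoulliKL (Q i j) (1 / 2) =
      if Q i j < 1 / 2 then bernoulliKL (Q i j) (1 / 2) else 0 := by
    intro j hj
    split_ifs with h
    · rfl
    · rw [le_antisymm hj (not_lt.1 h), bernoulliKL_self]
  have hle := fun j => bernoulliKL_half_add_le (hQ.nonneg i j) hδ.le hδ'
  simp only [promote]
  split_ifs with h1 h2
  · obtain ⟨rfl, h1, h2⟩ := h1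
    have h3 := hle b
    rw [hcase b h2] at h3
    simp only [drawInfo, involves, true_and, h1, true_or, if_true, false_and, if_false]
    linarith
  · obtain ⟨rfl, h3, h2⟩ := h2
    have h4 := hle a
    rw [hcase a h2] at h4
    have e1 : Q a b = 1 - Q b a := by linarith [hQ.add_eq_one a b]
    have e2 : 1 / 2 - δ = 1 - (1 / 2 + δ) := by ring
    simp only [drawInfo, involves, true_and, h3, or_true, if_true, false_and, if_false]
    rw [e1, e2, bernoulliKL_one_sub]
    linarith
  · rw [bernoulliKL_self]
    have : 0 ≤ involves i ((a, b), r) := by unfold involves; split_ifs <;> norm_num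
    positivity

/-- The cheapest regret per unit of information against the optimality of `i`. -/
noncomputable def infoPrice (Q : Matrix (Fin K) (Fin K) ℝ) (c i : Fin K) : ℝ :=
  ⨅ j : superiors Q i, (gap Q c i + gap Q c j) / (2 * bernoulliKL (Q i j) (1 / 2))

theorem infoPrice_nonneg {Q : Matrix (Fin K) (Fin K) ℝ} (hQ : IsPreferenceMatrix Q) {c : Fin K}
    (hc : IsCondorcetWinner Q c) (i : Fin K) : 0 ≤ infoPrice Q c i :=
  Real.iInf_nonneg fun _ => div_nonneg (add_nonneg (gap_nonneg hQ hc _) (gap_nonneg hQ hc _))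
    (mul_nonneg two_pos.le (bernoulliKL_half_nonneg (hQ.nonneg _ _) (hQ.le_one _ _)))

theorem infoPrice_mul_le {Q : Matrix (Fin K) (Fin K) ℝ} (hQ : IsPreferenceMatrix Q) {c : Fin K}
    (hc : IsCondorcetWinner Q c) {i j : Fin K} (hj : Q i j < 1 / 2) :
    infoPrice Q c i * bernoulliKL (Q i j) (1 / 2) ≤ (1 / 2) * (gap Q c i + gap Q c j) := by
  have hg := add_nonneg (gap_nonneg hQ hc i) (gap_nonneg hQ hc j)
  rcases (bernoulliKL_half_nonneg (hQ.nonneg i j) (hQ.le_one i j)).eq_or_lt with h | h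
  · rw [← h, mul_zero]; positivity
  · have : infoPrice Q c i ≤ (gap Q c i + gap Q c j) / (2 * bernoulliKL (Q i j) (1 / 2)) :=
      ciInf_le (Set.finite_range _).bddBelow (⟨j, hj⟩ : superiors Q i)
    rw [le_div_iff₀ (by positivity)] at this
    linarith

/-- A draw informs about one arm at most: its loser. -/
theorem sum_infoPrice_mul_drawInfo_le {Q : Matrix (Fin K) (Fin K) ℝ} (hQ : IsPreferenceMatrix Q)
    {c : Fin K} (hc : IsCondorcetWinner Q c) (d : Draw K) :
    ∑ i ∈ Finset.univ.erase c, infoPrice Q c i * drawInfo Q i d ≤ drawRegret Q c d := by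
  obtain ⟨⟨a, b⟩, r⟩ := d
  have hz : ∀ i, drawInfo Q i ((a, b), r) ≠ 0 →
      i = a ∧ Q a b < 1 / 2 ∨ i = b ∧ Q b a < 1 / 2 := by
    intro i h
    unfold drawInfo at h
    split_ifs at h with h1 h2
    · obtain ⟨rfl, h1⟩ := h1; exact .inl ⟨rfl, h1⟩
    · obtain ⟨rfl, h2⟩ := h2; exact .inr ⟨rfl, h2⟩
    · exact absurd rfl h
  have hadd := hQ.add_eq_one a b
  have hn := drawRegret_nonneg hQ hc ((a, b), r)
  have hone : ∀ i₀, (∀ i, drawInfo Q i ((a, b), r) ≠ 0 → i = i₀) →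
      infoPrice Q c i₀ * drawInfo Q i₀ ((a, b), r) ≤ drawRegret Q c ((a, b), r) →
      ∑ i ∈ Finset.univ.erase c, infoPrice Q c i * drawInfo Q i ((a, b), r) ≤
        drawRegret Q c ((a, b), r) := by
    intro i₀ huniq hle
    by_cases hmem : i₀ ∈ Finset.univ.erase c
    · rwa [Finset.sum_eq_single_of_mem i₀ hmem]
      intro i _ hne
      rw [not_imp_comm.1 (huniq i) hne, mul_zero]
    · rw [Finset.sum_eq_zero]
      · exact hn
      · intro i hi
        have hne : i ≠ i₀ := fun h => hmem (h ▸ hi)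
        rw [not_imp_comm.1 (huniq i) hne, mul_zero]
  rcases lt_trichotomy (Q a b) (1 / 2) with h | h | h
  · refine hone a (fun i hi => ?_) ?_
    · rcases hz i hi with h' | h'
      · exact h'.1
      · linarith [h'.2]
    · have := infoPrice_mul_le hQ hc h
      simp only [drawInfo, drawRegret, h, true_and, if_true]
      linarith
  · refine hone a (fun i hi => ?_) ?_
    · rcases hz i hi with h' | h' <;> linarith [h'.2]
    · have h0 : drawInfo Q a ((a, b), r) = 0 := by
        by_contra h'
        rcases hz a h' with h' | h' <;> linarith [h'.2]
      rwa [h0, mul_zero]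
  · have h' : Q b a < 1 / 2 := by linarith
    refine hone b (fun i hi => ?_) ?_
    · rcases hz i hi with h'' | h''
      · linarith [h''.2]
      · exact h''.1
    · have := infoPrice_mul_le hQ hc h'
      have hnot : ¬ (a = b ∧ Q b b < 1 / 2) := by rw [hQ.diag b]; simp
      simp only [drawInfo, drawRegret, hnot, h', true_and, if_true, if_false]
      linarith

/-! ### The information needed by a consistent algorithm -/

/-- On `[0, 1]` the graph of `y ↦ exp (l * y)` lies below its chord. -/
theorem exp_mul_le_one_add {l y : ℝ} (h0 : 0 ≤ y) (h1 : y ≤ 1) :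
    Real.exp (l * y) ≤ 1 + Real.exp l * y := by
  have h := convexOn_exp.2 (Set.mem_univ 0) (Set.mem_univ l) (sub_nonneg.2 h1) h0 (by ring)
  simp only [smul_eq_mul, mul_zero, zero_add, Real.exp_zero, mul_one] at h
  rw [mul_comm l y]
  linarith [mul_comm y (Real.exp l)]

/-- Under a consistent algorithm the draws inform about every suboptimal arm `i` by `log T` nats
up to lower order: the algorithm has to tell `Q` from its modifications in which `i` wins. The
error term in the regret pays for raising the entries of `i` above `1/2` rather than to `1/2`. -/
theorem eventually_log_le_expect_drawInfo (hM : 0 < M) {A : Algorithm K M G γ}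
    (hA : Consistent A) {Q : Matrix (Fin K) (Fin K) ℝ} (hQ : IsPreferenceMatrix Q) {c : Fin K}
    (hc : IsCondorcetWinner Q c) {i : Fin K} (hi : i ≠ c) {ε : ℝ} (hε : 0 < ε) :
    ∀ᶠ T : ℕ in atTop, (1 - ε) * Real.log T ≤
      expect (A T) Q T (drawSum (drawInfo Q i)) + ε * expectedRegret A Q c T := by
  set k := 2 / gap Q c i with hk
  have hkpos : 0 < k := by
    have : 0 < gap Q c i := by simpa [gap] using hc i hi
    positivity
  have hMR : (0 : ℝ) < M := by exact_mod_cast hM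
  obtain ⟨p, hp, hpε, hp1⟩ : ∃ p : ℝ, 0 < p ∧ 3 * p ≤ ε ∧ p < 1 :=
    ⟨min (ε / 3) (1 / 2), by positivity, by linarith [min_le_left (ε / 3) (1 / 2 : ℝ)],
      (min_le_right _ _).trans_lt (by norm_num)⟩
  obtain ⟨δ, hδ, hδ', hδε⟩ : ∃ δ : ℝ, 0 < δ ∧ δ < 1 / 2 ∧ -Real.log (1 - 2 * δ) * k ≤ ε := by
    refine ⟨(1 - Real.exp (-(ε / k))) / 2, ?_, ?_, ?_⟩
    · have : Real.exp (-(ε / k)) < 1 := Real.exp_lt_one_iff.2 (neg_lt_zero.2 (by positivity))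
      linarith
    · linarith [Real.exp_pos (-(ε / k))]
    · rw [show 1 - 2 * ((1 - Real.exp (-(ε / k))) / 2) = Real.exp (-(ε / k)) by ring, Real.log_exp,
        neg_neg, div_mul_cancel₀ _ hkpos.ne']
  set Q' := promote Q i δ with hQ'def
  have hQ' : IsPreferenceMatrix Q' := promote_isPreferenceMatrix hQ i hδ hδ'
  have hi' : IsCondorcetWinner Q' i := promote_isCondorcetWinner Q i hδ
  obtain ⟨k', hk', hns⟩ := exists_notSelf_le hQ' hi'
  have ev1 := (hA Q' i hQ' hi' p hp).bound (show 0 < M / k' by positivity)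
  have ev2 := (hA Q c hQ hc 1 one_pos).bound (show 0 < p * M / k by positivity)
  have ev3 : ∀ᶠ T : ℕ in atTop, Real.log 2 / p ≤ Real.log T :=
    (Real.tendsto_log_atTop.comp tendsto_natCast_atTop_atTop).eventually_ge_atTop _
  filter_upwards [ev1, ev2, ev3, eventually_gt_atTop 0] with T h1 h2 h3 hT
  have hTR : (0 : ℝ) < T := by exact_mod_cast hT
  have hMT : (0 : ℝ) < M * T := by positivity
  have hlogT : 0 ≤ Real.log T := Real.log_natCast_nonneg T
  have hR := expectedRegret_nonneg A hQ hc T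
  have hR' := expectedRegret_nonneg A hQ' hi' T
  rw [Real.norm_of_nonneg hR', Real.norm_of_nonneg (by positivity)] at h1
  rw [Real.norm_of_nonneg hR, Real.rpow_one, Real.norm_of_nonneg hTR.le] at h2
  rw [div_le_iff₀ hp] at h3
  -- `Y` is the fraction of the draws that are not of `i` with itself: it is close to one under `Q`
  -- and close to zero under `Q'`.
  set Y : History K M T → ℝ := fun ω => (M * T : ℝ)⁻¹ * drawSum (notSelf i) ω with hY
  have hY0 : ∀ ω, 0 ≤ Y ω := fun ω => mul_nonneg (by positivity) <|
    Finset.sum_nonneg fun _ _ => Finset.sum_nonneg fun _ _ => by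
      unfold notSelf; split_ifs <;> norm_num
  have hY1 : ∀ ω, Y ω ≤ 1 := fun ω => by
    have : drawSum (notSelf i) ω ≤ M * T :=
      (drawSum_mono (g := fun _ => 1) (fun d => by unfold notSelf; split_ifs <;> norm_num)
        ω).trans_eq (drawSum_one ω)
    rw [hY]
    simp only
    rwa [inv_mul_le_iff₀ hMT, mul_one]
  have hYQ' : expect (A T) Q' T Y ≤ (T : ℝ) ^ (p - 1) := by
    have e1 : expect (A T) Q' T (drawSum (notSelf i)) ≤ k' * expectedRegret A Q' i T := by
      rw [expectedRegret_eq_expect, ← expect_const_mul]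
      exact expect_mono _ hQ' fun ω =>
        (drawSum_mono hns ω).trans_eq (drawSum_const_mul k' (drawRegret Q' i) ω)
    rw [hY, expect_const_mul, inv_mul_le_iff₀ hMT, Real.rpow_sub_one hTR.ne']
    calc _ ≤ k' * (M / k' * T ^ p) := e1.trans (mul_le_mul_of_nonneg_left h1 hk'.le)
      _ = _ := by field_simp
  have hinv : expect (A T) Q T (drawSum (involves i)) ≤ k * expectedRegret A Q c T := by
    rw [expectedRegret_eq_expect, ← expect_const_mul]
    exact expect_mono _ hQ fun ω =>
      (drawSum_mono (involves_le hQ hc hi) ω).trans_eq (drawSum_const_mul k _ ω)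
  have hYQ : 1 - p ≤ expect (A T) Q T Y := by
    have e1 : (M * T : ℝ) ≤ expect (A T) Q T (drawSum (notSelf i)) +
        expect (A T) Q T (drawSum (involves i)) := by
      rw [← expect_add, ← expect_const (A T) Q T (M * T : ℝ)]
      exact expect_mono _ hQ fun ω => by
        rw [← drawSum_one ω, ← drawSum_add]
        exact drawSum_mono (one_le_notSelf_add_involves i) ω
    have e2 : k * expectedRegret A Q c T ≤ p * (M * T) :=
      (mul_le_mul_of_nonneg_left h2 hkpos.le).trans_eq (by field_simp)
    rw [hY, expect_const_mul, le_inv_mul_iff₀ hMT]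
    linarith
  -- This exponent is the largest for which consistency bounds the exponential moment under `Q'`.
  have hmom : expect (A T) Q' T (fun ω => Real.exp ((1 - p) * Real.log T * Y ω)) ≤ 2 := by
    calc _ ≤ expect (A T) Q' T (fun ω => 1 + Real.exp ((1 - p) * Real.log T) * Y ω) :=
          expect_mono _ hQ' fun ω => exp_mul_le_one_add (hY0 ω) (hY1 ω)
      _ = 1 + Real.exp ((1 - p) * Real.log T) * expect (A T) Q' T Y := by
          rw [expect_add, expect_const, expect_const_mul]
      _ ≤ 1 + Real.exp ((1 - p) * Real.log T) * (T : ℝ) ^ (p - 1) := by gcongr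
      _ = 2 := by
          rw [Real.rpow_def_of_pos hTR, ← Real.exp_add]
          ring_nf
          norm_num
  have hmain := expect_le_expect_bernoulliKL_add_log (A T) hQ hQ' (promote_eq_or Q i hδ hδ') T
    _ two_pos hmom
  rw [expect_const_mul] at hmain
  have hkl : expect (A T) Q T (drawSum fun d => bernoulliKL (Q d.1.1 d.1.2) (Q' d.1.1 d.1.2)) ≤
      expect (A T) Q T (drawSum (drawInfo Q i)) +
        -Real.log (1 - 2 * δ) * expect (A T) Q T (drawSum (involves i)) := by
    rw [← expect_const_mul, ← expect_add]
    exact expect_mono _ hQ fun ω => by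
      rw [← drawSum_const_mul, ← drawSum_add]
      exact drawSum_mono (bernoulliKL_promote_le hQ i hδ hδ') ω
  have hη : 0 ≤ -Real.log (1 - 2 * δ) :=
    neg_nonneg.2 (Real.log_nonpos (by linarith) (by linarith))
  have f1 : -Real.log (1 - 2 * δ) * expect (A T) Q T (drawSum (involves i)) ≤
      ε * expectedRegret A Q c T :=
    calc _ ≤ -Real.log (1 - 2 * δ) * (k * expectedRegret A Q c T) := by gcongr
      _ = -Real.log (1 - 2 * δ) * k * expectedRegret A Q c T := by ring
      _ ≤ _ := by gcongr
  have f2 : (1 - p) * Real.log T * (1 - p) ≤ (1 - p) * Real.log T * expect (A T) Q T Y :=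
    mul_le_mul_of_nonneg_left hYQ (mul_nonneg (by linarith) hlogT)
  have f3 : (1 - ε) * Real.log T ≤ (1 - 3 * p) * Real.log T := by gcongr
  nlinarith [mul_nonneg (sq_nonneg p) hlogT]

theorem sum_infoPrice_mul_expect_drawInfo_le (A : Algorithm K M G γ)
    {Q : Matrix (Fin K) (Fin K) ℝ} (hQ : IsPreferenceMatrix Q) {c : Fin K}
    (hc : IsCondorcetWinner Q c) (T : ℕ) :
    ∑ i ∈ Finset.univ.erase c, infoPrice Q c i * expect (A T) Q T (drawSum (drawInfo Q i)) ≤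
      expectedRegret A Q c T := by
  rw [expectedRegret_eq_expect]
  simp only [← expect_const_mul, ← expect_sum, ← drawSum_const_mul, ← drawSum_sum]
  exact expect_mono _ hQ (drawSum_mono (sum_infoPrice_mul_drawInfo_le hQ hc))

end DuelingBandit

theorem theorem1 (K M : ℕ) (G : SimpleGraph (Fin M)) (hG : G.Connected) (γ : ℕ)
    (A : DuelingBandit.Algorithm K M G γ) (hA : DuelingBandit.Consistent A)
    (Q : Matrix (Fin K) (Fin K) ℝ) (hQ : DuelingBandit.IsPreferenceMatrix Q)
    (c : Fin K) (hc : DuelingBandit.IsCondorcetWinner Q c) :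
    ((∑ i ∈ Finset.univ.erase c, ⨅ j : DuelingBandit.superiors Q i,
        (DuelingBandit.gap Q c i + DuelingBandit.gap Q c j) /
          (2 * DuelingBandit.bernoulliKL (Q i j) (1 / 2)) : ℝ) : EReal) ≤
      liminf (fun T : ℕ =>
        ((DuelingBandit.expectedRegret A Q c T / Real.log T : ℝ) : EReal)) atTop := by
  have hM : 0 < M := Fin.pos_iff_nonempty.2 hG.nonempty
  set S : ℝ := ∑ i ∈ Finset.univ.erase c, DuelingBandit.infoPrice Q c i with hS
  change (S : EReal) ≤ _
  have hS0 : 0 ≤ S := Finset.sum_nonneg fun i _ => DuelingBandit.infoPrice_nonneg hQ hc i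
  -- Weighting the information bounds by their prices gives `(1 - ε) S log T ≤ (1 + ε S) R(T)`.
  have key : ∀ ε : ℝ, 0 < ε →
      (((1 - ε) * S / (1 + ε * S) : ℝ) : EReal) ≤ liminf (fun T : ℕ =>
        ((DuelingBandit.expectedRegret A Q c T / Real.log T : ℝ) : EReal)) atTop := by
    intro ε hε
    refine le_liminf_of_le (by isBoundedDefault) ?_
    have hall : ∀ᶠ T : ℕ in atTop, ∀ i ∈ Finset.univ.erase c, (1 - ε) * Real.log T ≤
        DuelingBandit.expect (A T) Q T (DuelingBandit.drawSum (DuelingBandit.drawInfo Q i)) +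
          ε * DuelingBandit.expectedRegret A Q c T :=
      (Filter.eventually_all_finset _).2 fun i hi =>
        DuelingBandit.eventually_log_le_expect_drawInfo hM hA hQ hc (Finset.ne_of_mem_erase hi) hε
    filter_upwards [hall, eventually_gt_atTop 1] with T hT hT1
    have hlog : 0 < Real.log T := Real.log_pos (by exact_mod_cast hT1)
    rw [EReal.coe_le_coe_iff, div_le_div_iff₀ (by positivity) hlog]
    have h1 : ∑ i ∈ Finset.univ.erase c, DuelingBandit.infoPrice Q c i * ((1 - ε) * Real.log T) ≤
        ∑ i ∈ Finset.univ.erase c, DuelingBandit.infoPrice Q c i *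
          (DuelingBandit.expect (A T) Q T (DuelingBandit.drawSum (DuelingBandit.drawInfo Q i)) +
            ε * DuelingBandit.expectedRegret A Q c T) :=
      Finset.sum_le_sum fun i hi =>
        mul_le_mul_of_nonneg_left (hT i hi) (DuelingBandit.infoPrice_nonneg hQ hc i)
    have h2 := DuelingBandit.sum_infoPrice_mul_expect_drawInfo_le A hQ hc T
    simp only [mul_add, Finset.sum_add_distrib, ← Finset.sum_mul, ← hS] at h1
    nlinarith
  have hlim : Tendsto (fun ε : ℝ => (((1 - ε) * S / (1 + ε * S) : ℝ) : EReal)) (𝓝[>] 0)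
      (𝓝 (S : EReal)) := by
    refine (continuous_coe_real_ereal.tendsto S).comp ?_
    have hcont : ContinuousAt (fun ε : ℝ => (1 - ε) * S / (1 + ε * S)) 0 :=
      ContinuousAt.div (by fun_prop) (by fun_prop) (by simp)
    have := hcont.tendsto
    simp only [sub_zero, one_mul, zero_mul, add_zero, div_one] at this
    exact this.mono_left nhdsWithin_le_nhds
  exact le_of_tendsto hlim (eventually_nhdsWithin_of_forall key)
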